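/- A single server of unit speed serves two parallel queues of unlimited capacity. Jobs arrive at queue $j\in\{1,2\}$ according to a Poisson process of rate $\lambda_j>0$ and have i.i.d. service times with law $B_j$ on $(0,\infty)$ and finite mean $1/\mu_j$; the two Poisson processes and all service times are independent, and $\varrho=\lambda_1/\mu_1+\lambda_2/\mu_2<1$. Let $W_j(t)$ be the work brought to queue $j$ during $[0,t[$. Under Shortest Queue First (SQF) the workloads $U_1(t),U_2(t)\ge 0$ satisfy $\mathrm dU_j(t)=\mathrm dW_j(t)-I_j(t)\,\mathrm dt$, where $$I_1=\mathbf 1_{\{0<U_1\le U_2\}}+\mathbf 1_{\{0<U_1,\,U_2=0\}},\qquad I_2=\mathbf 1_{\{0<U_2<U_1\}}+\mathbf 1_{\{0<U_2,\,U_1=0\}},$$ the initial state being independent of the arrivals. Let $(U_1(t),U_2(t))_{t\ge 0}$ be stationary with stationary distribution $\Phi$, and assume that $\Phi$ has densities, continuous and bounded on their domains: $\varphi_1$ on $\Gamma_1=\{0<u_1<u_2\}$ and $\varphi_2$ on $\Gamma_2=\{0<u_2<u_1\}$ (with respect to planar Lebesgue measure), $\psi_1$ on the half-line $\{u_1>0,\,u_2=0\}$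 and $\psi_2$ on the half-line $\{u_1=0,\,u_2>0\}$ (with respect to length). Put $$F_k(s_1,s_2)=\int_{\Gamma_k}e^{-s_1u_1-s_2u_2}\varphi_k(u_1,u_2)\,\mathrm du_1\,\mathrm du_2\quad(\Re s_1\ge 0,\ \Re s_2\ge 0),\qquad G_k(s)=\int_0^\infty e^{-su}\psi_k(u)\,\mathrm du\quad(\Re s\ge 0)$$ for $k=1,2$. For $j\in\{1,2\}$, let $\overline U_j(t)$ be the workload at time $t$ of queue $j$ in the system with the same arrivals, started from any state independent of the arrivals, in which the other queue has preemptive Head-of-Line (HoL) priority over queue $j$ (queue $j$ is served, at unit rate, exactly when it is non-empty and the other queue is empty; the other queue is served whenever it is non-empty). Let $\overline U_j$ be the limit in distribution of $\overline U_j(t)$ as $t\to\infty$. Assume that, for some real $\widetilde s_j<0$, the Laplace transform $s\mapsto\mathbb E(e^{-s\overline U_j})$, defined for $\Re s\ge 0$, is (extends to) an analytic function on $\{s\in\mathbb C\mid \Re s>\widetilde s_j\}$, for $j=1,2$. Then $F_1$ can be analytically extended to $$\widetilde{\mathbf\Omega}_1=\{(s_1,s_2)\in\mathbb C^2\mid \Re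 s_2>\max(\widetilde s_2,\widetilde s_2-\Re s_1)\}$$ and $G_2$ can be analytically extended to $\{s_2\in\mathbb C\mid\Re s_2>\widetilde s_2\}$. Similarly, $F_2$ can be analytically extended to $$\widetilde{\mathbf\Omega}_2=\{(s_1,s_2)\in\mathbb C^2\mid \Re s_1>\max(\widetilde s_1,\widetilde s_1-\Re s_2)\}$$ and $G_1$ can be analytically extended to $\{s_1\in\mathbb C\mid\Re s_1>\widetilde s_1\}$. -/

import Mathlib

open MeasureTheory ProbabilityTheory Set Filter Topology

noncomputable section

namespace SQF

/-! Two parallel queues, indexed by `0` and `1` in `Fin 2` for queues no. 1 and no. 2. A workload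
state is a pair `u = (u₁, u₂) : ℝ × ℝ` with nonnegative components. -/

variable {Ω : Type*} [MeasurableSpace Ω]

/-- Service time distribution: a probability measure carried by `(0, ∞)` with finite mean
`1 / μ`, where `μ > 0`. -/
structure IsServiceLaw (B : Measure ℝ) (μ : ℝ) : Prop where
  isProbabilityMeasure : IsProbabilityMeasure B
  pos : B (Iic 0) = 0
  rate_pos : 0 < μ
  integrable : Integrable (fun x : ℝ => x) B
  mean : ∫ x, x ∂B = 1 / μ

/-- Arrival data of the two queues. At queue `j`, jobs arrive according to a Poisson process of rate
`lam j` (the interarrival times `τ j n` are i.i.d. exponential), the service times `T j n` are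
i.i.d. with law `B j`, and all these variables are independent. -/
structure IsArrivalModel (P : Measure Ω) (lam : Fin 2 → ℝ) (B : Fin 2 → Measure ℝ)
    (τ T : Fin 2 → ℕ → Ω → ℝ) : Prop where
  rate_pos : ∀ j, 0 < lam j
  interarrival_law : ∀ j n, HasLaw (τ j n) (expMeasure (lam j)) P
  service_law : ∀ j n, HasLaw (T j n) (B j) P
  indep : iIndepFun
    (Sum.elim (fun p : Fin 2 × ℕ => τ p.1 p.2) (fun p : Fin 2 × ℕ => T p.1 p.2)) P

/-- Arrival epoch of the `(n+1)`-st job. -/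
def arrivalTime (τ : ℕ → Ω → ℝ) (n : ℕ) (ω : Ω) : ℝ :=
  ∑ k ∈ Finset.range (n + 1), τ k ω

/-- `A(t)`, the number of arrivals within `[0, t[`. -/
def arrivalCount (τ : ℕ → Ω → ℝ) (t : ℝ) (ω : Ω) : ℕ :=
  {n : ℕ | arrivalTime τ n ω < t}.ncard

/-- `W(t)`, the total work brought within `[0, t[`. -/
def work (τ T : ℕ → Ω → ℝ) (t : ℝ) (ω : Ω) : ℝ :=
  ∑ n ∈ Finset.range (arrivalCount τ t ω), T n ω

/-- A service policy: the instantaneous service rates of the two queues, given the workloads. -/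
abbrev Policy := ℝ × ℝ → ℝ × ℝ

open Classical in
/-- Shortest Queue First. -/
def sqf : Policy := fun u =>
  ((if 0 < u.1 ∧ u.1 ≤ u.2 then 1 else 0) + (if 0 < u.1 ∧ u.2 = 0 then 1 else 0),
   (if 0 < u.2 ∧ u.2 < u.1 then 1 else 0) + (if 0 < u.2 ∧ u.1 = 0 then 1 else 0))

open Classical in
/-- Preemptive Head of Line, queue no. 1 having priority over queue no. 2. -/
def hol₁ : Policy := fun u =>
  (if 0 < u.1 then 1 else 0, if 0 < u.2 ∧ u.1 = 0 then 1 else 0)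

open Classical in
/-- Preemptive Head of Line, queue no. 2 having priority over queue no. 1. -/
def hol₂ : Policy := fun u =>
  (if 0 < u.1 ∧ u.2 = 0 then 1 else 0, if 0 < u.2 then 1 else 0)

/-- `U` is the workload process (in times `t ≥ 0`) of the two queues fed by the arrival data
`τ, T` and operated with the policy `I`: `dU_j(t) = dW_j(t) - I_j(U(t)) dt`, in integrated form,
with a nonnegative initial state that is independent of the arrival data. -/
structure IsWorkload (P : Measure Ω) (τ T : Fin 2 → ℕ → Ω → ℝ) (I : Policy)
    (U : ℝ → Ω → ℝ × ℝ) : Prop where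
  aemeasurable : ∀ t, AEMeasurable (U t) P
  initial_indep :
    IndepFun (U 0) (fun ω (p : Fin 2 × ℕ) => (τ p.1 p.2 ω, T p.1 p.2 ω)) P
  nonneg : ∀ᵐ ω ∂P, ∀ t, 0 ≤ t → 0 ≤ (U t ω).1 ∧ 0 ≤ (U t ω).2
  integrable : ∀ᵐ ω ∂P, ∀ t, 0 ≤ t →
    IntervalIntegrable (fun s => (I (U s ω)).1) volume 0 t ∧
    IntervalIntegrable (fun s => (I (U s ω)).2) volume 0 t
  evolution : ∀ᵐ ω ∂P, ∀ t, 0 ≤ t →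
    (U t ω).1 = (U 0 ω).1 + work (τ 0) (T 0) t ω - ∫ s in (0 : ℝ)..t, (I (U s ω)).1 ∧
    (U t ω).2 = (U 0 ω).2 + work (τ 1) (T 1) t ω - ∫ s in (0 : ℝ)..t, (I (U s ω)).2

/-- The workload process `U` is stationary with stationary distribution `Φ`. -/
def HasStationaryLaw (P : Measure Ω) (U : ℝ → Ω → ℝ × ℝ) (Φ : Measure (ℝ × ℝ)) : Prop :=
  ∀ t, 0 ≤ t → HasLaw (U t) Φ P

/-- The open cone `0 < u₁ < u₂`. -/
def Γ₁ : Set (ℝ × ℝ) := {u | 0 < u.1 ∧ u.1 < u.2}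

/-- The open cone `0 < u₂ < u₁`. -/
def Γ₂ : Set (ℝ × ℝ) := {u | 0 < u.2 ∧ u.2 < u.1}

/-- The boundary half-line `u₁ > 0`, `u₂ = 0`. -/
def δ₁ : Set (ℝ × ℝ) := {u | 0 < u.1 ∧ u.2 = 0}

/-- The boundary half-line `u₁ = 0`, `u₂ > 0`. -/
def δ₂ : Set (ℝ × ℝ) := {u | u.1 = 0 ∧ 0 < u.2}

/-- A regular density on `D`: nonnegative, continuous and bounded there. -/
structure IsRegular {E : Type*} [TopologicalSpace E] (f : E → ℝ) (D : Set E) : Prop where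
  nonneg : ∀ x ∈ D, 0 ≤ f x
  continuousOn : ContinuousOn f D
  bounded : ∃ C, ∀ x ∈ D, f x ≤ C

/-- `Φ` has regular densities `φ₁`, `φ₂` on the cones `Γ₁`, `Γ₂` (with respect to planar Lebesgue
measure) and `ψ₁`, `ψ₂` on the half-lines `δ₁`, `δ₂` (with respect to length). -/
structure HasRegularDensities (Φ : Measure (ℝ × ℝ)) (φ₁ φ₂ : ℝ × ℝ → ℝ) (ψ₁ ψ₂ : ℝ → ℝ) :
    Prop where
  regular_φ₁ : IsRegular φ₁ Γ₁
  regular_φ₂ : IsRegular φ₂ Γ₂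
  regular_ψ₁ : IsRegular ψ₁ (Ioi 0)
  regular_ψ₂ : IsRegular ψ₂ (Ioi 0)
  cone₁ : Φ.restrict Γ₁ = (volume.restrict Γ₁).withDensity (fun u => ENNReal.ofReal (φ₁ u))
  cone₂ : Φ.restrict Γ₂ = (volume.restrict Γ₂).withDensity (fun u => ENNReal.ofReal (φ₂ u))
  boundary₁ : Φ.restrict δ₁ =
    ((volume.restrict (Ioi 0)).withDensity (fun x => ENNReal.ofReal (ψ₁ x))).map
      (fun x : ℝ => (x, (0 : ℝ)))
  boundary₂ : Φ.restrict δ₂ =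
    ((volume.restrict (Ioi 0)).withDensity (fun x => ENNReal.ofReal (ψ₂ x))).map
      (fun x : ℝ => ((0 : ℝ), x))

/-- Bivariate Laplace transform of a density `φ` carried by `D`. -/
def laplace₂ (D : Set (ℝ × ℝ)) (φ : ℝ × ℝ → ℝ) (s : ℂ × ℂ) : ℂ :=
  ∫ u in D, Complex.exp (-(s.1 * (u.1 : ℂ) + s.2 * (u.2 : ℂ))) * (φ u : ℂ)

/-- Laplace transform of a density `ψ` carried by `(0, ∞)`. -/
def laplace₁ (ψ : ℝ → ℝ) (s : ℂ) : ℂ :=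
  ∫ x in Ioi (0 : ℝ), Complex.exp (-(s * (x : ℂ))) * (ψ x : ℂ)

/-- Laplace transform `s ↦ E(exp (-s X))` of a random variable `X`. -/
def laplaceRV (P : Measure Ω) (X : Ω → ℝ) (s : ℂ) : ℂ :=
  ∫ ω, Complex.exp (-(s * (X ω : ℂ))) ∂P

/-- The function `f`, given on `D`, can be analytically extended to `D'`. -/
def ExtendsAnalytically {E : Type*} [NormedAddCommGroup E] [NormedSpace ℂ E]
    (f : E → ℂ) (D D' : Set E) : Prop :=
  D ⊆ D' ∧ ∃ g : E → ℂ, AnalyticOnNhd ℂ g D' ∧ EqOn g f D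

/-- The closed half-plane `Re s ≥ 0`. -/
def closedHalfPlane : Set ℂ := {s | 0 ≤ s.re}

/-- The set `Re s₁ ≥ 0`, `Re s₂ ≥ 0`. -/
def closedQuadrant : Set (ℂ × ℂ) := {s | 0 ≤ s.1.re ∧ 0 ≤ s.2.re}

end SQF

end

/-! Everything reduces to exponential moments of the stationary law: if `exp (θ * u.2)` is
`Φ`-integrable for all `0 ≤ θ < -a₂`, the integrals defining F₁ and G₂ converge absolutely on the
claimed domains and are analytic there. The extensions are thus the same integrals. F₂ and G₁ follow
by exchanging the queues.

The moments come from a pathwise comparison. SQF is work-conserving, so once its total workload has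
vanished, it stays below the HoL total. The queue with HoL priority is served whenever it is
non-empty, so once it has emptied, it carries no more work than under SQF. Subtracting, the other
queue eventually carries at most its HoL workload (`eventually_le_of_priority`). Both emptying times
exist by stability and the strong law of large numbers.

Stationarity on one side and convergence in distribution on the other turn this into stochastic
domination by the limit (`integral_le_of_eventually_le`). The limit has exponential moments up to
`-a` by Landau's theorem on transforms of nonnegative variables
(`integrable_exp_of_extendsAnalytically`).

The domain of F₁ reflects the cone 0 < u₁ < u₂: the exponent -(σ₁u₁ + σ₂u₂) is at most θu₂ there as
soon as this holds on the extreme rays u₁ = 0 and u₁ = u₂, that is, -σ₂ ≤ θ and -(σ₁ + σ₂) ≤ θ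
(`exponent_le`). -/

noncomputable section

namespace SQF

/-! ### Analyticity of integrals of exponentials of linear forms -/

section Analytic

variable {α : Type*} [MeasurableSpace α] {ν : Measure α}
  {E : Type*} [NormedAddCommGroup E] [NormedSpace ℂ E]

/-- The Taylor series of `s ↦ exp (ℓ s)` for a continuous linear form `ℓ`. -/
def expFormSeries (n : ℕ) (ℓ : E →L[ℂ] ℂ) : E [×n]→L[ℂ] ℂ :=
  (NormedSpace.expSeries ℂ ℂ n).compContinuousLinearMap fun _ => ℓ

lemma expFormSeries_apply (n : ℕ) (ℓ : E →L[ℂ] ℂ) (y : E) :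
    expFormSeries n ℓ (fun _ => y) = (ℓ y) ^ n / (n.factorial : ℂ) := by
  rw [expFormSeries, ContinuousMultilinearMap.compContinuousLinearMap_apply,
    NormedSpace.expSeries_apply_eq_div]

lemma norm_expFormSeries_le (n : ℕ) (ℓ : E →L[ℂ] ℂ) :
    ‖expFormSeries n ℓ‖ ≤ ‖ℓ‖ ^ n / (n.factorial : ℝ) := by
  refine ContinuousMultilinearMap.opNorm_le_bound (by positivity) fun m => ?_
  simp only [expFormSeries, NormedSpace.expSeries,
    ContinuousMultilinearMap.compContinuousLinearMap_apply, smul_apply,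
    ContinuousMultilinearMap.mkPiAlgebraFin_apply, smul_eq_mul, norm_mul, norm_inv,
    RCLike.norm_natCast]
  rw [List.prod_ofFn, norm_prod, div_mul_eq_mul_div, inv_mul_eq_div]
  gcongr
  calc ∏ i, ‖ℓ (m i)‖ ≤ ∏ i : Fin n, ‖ℓ‖ * ‖m i‖ :=
        Finset.prod_le_prod (fun _ _ => norm_nonneg _) fun i _ => ℓ.le_opNorm _
    _ = ‖ℓ‖ ^ n * ∏ i, ‖m i‖ := by simp [Finset.prod_mul_distrib]

/-- Gives the measurability in `u` of the Taylor coefficients that are integrated below. -/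
lemma continuous_expFormSeries (n : ℕ) :
    Continuous (expFormSeries n : (E →L[ℂ] ℂ) → E [×n]→L[ℂ] ℂ) := by
  have h := (ContinuousMultilinearMap.compContinuousLinearMapContinuousMultilinear ℂ
    (fun _ : Fin n => E) (fun _ : Fin n => ℂ) ℂ).cont
  exact (h.comp (continuous_pi fun _ => continuous_id)).clm_apply continuous_const

lemma pow_div_factorial_mul_le_exp {x r : ℝ} (hx : 0 ≤ x) (hr : 0 ≤ r) (n : ℕ) :
    x ^ n / (n.factorial : ℝ) * r ^ n ≤ Real.exp (r * x) := by
  have := Real.pow_div_factorial_le_exp (r * x) (by positivity) n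
  calc _ = (r * x) ^ n / (n.factorial : ℝ) := by rw [mul_pow]; ring
    _ ≤ _ := this

/-- Analyticity of the Laplace transform of a measure, in any number of variables. -/
theorem analyticAt_integral_cexp {ℓ : α → E →L[ℂ] ℂ} (hℓ : AEStronglyMeasurable ℓ ν) {s : E}
    {r : ℝ} (hr : 0 < r)
    (hint : Integrable (fun u => Real.exp ((ℓ u s).re + r * ‖ℓ u‖)) ν) :
    AnalyticAt ℂ (fun s => ∫ u, Complex.exp (ℓ u s) ∂ν) s := by
  -- `F n u` is the `n`-th Taylor coefficient at `s` of the integrand; the power series of the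
  -- integral is obtained by integrating these. The margin `r * ‖ℓ u‖` in `hint` makes its radius at
  -- least `r`.
  set F : ∀ n : ℕ, α → E [×n]→L[ℂ] ℂ := fun n u => Complex.exp (ℓ u s) • expFormSeries n (ℓ u)
    with hF
  have hexp : AEStronglyMeasurable (fun u => Complex.exp (ℓ u s)) ν :=
    Complex.continuous_exp.comp_aestronglyMeasurable
      ((ContinuousLinearMap.apply ℂ ℂ s).continuous.comp_aestronglyMeasurable hℓ)
  have hFm : ∀ n, AEStronglyMeasurable (F n) ν := fun n =>
    hexp.smul ((continuous_expFormSeries n).comp_aestronglyMeasurable hℓ)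
  have hFn : ∀ n u, ‖F n u‖ * r ^ n ≤ Real.exp ((ℓ u s).re + r * ‖ℓ u‖) := fun n u => by
    rw [hF, norm_smul, Complex.norm_exp, Real.exp_add, mul_assoc]
    gcongr
    exact (mul_le_mul_of_nonneg_right (norm_expFormSeries_le n _) (by positivity)).trans
      (pow_div_factorial_mul_le_exp (norm_nonneg _) hr.le n)
  have hFi : ∀ n, Integrable (F n) ν := fun n => by
    refine (hint.mul_const ((r ^ n)⁻¹)).mono' (hFm n) (ae_of_all _ fun u => ?_)
    rw [← div_eq_mul_inv, le_div_iff₀ (by positivity)]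
    exact hFn n u
  set p : FormalMultilinearSeries ℂ E ℂ := fun n => ∫ u, F n u ∂ν with hp
  have hrad : ENNReal.ofReal r ≤ p.radius := by
    refine p.le_radius_of_bound (∫ u, Real.exp ((ℓ u s).re + r * ‖ℓ u‖) ∂ν) fun n => ?_
    rw [Real.coe_toNNReal _ hr.le]
    calc ‖p n‖ * r ^ n ≤ (∫ u, ‖F n u‖ ∂ν) * r ^ n := by
          gcongr; exact norm_integral_le_integral_norm _
      _ = ∫ u, ‖F n u‖ * r ^ n ∂ν := (integral_mul_const _ _).symm
      _ ≤ _ := integral_mono ((hFi n).norm.mul_const _) hint (hFn n)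
  refine ⟨p, ENNReal.ofReal r, hrad, by simpa using hr, fun {y} hy => ?_⟩
  have hy' : ‖y‖ ≤ r := by
    rw [Metric.mem_eball, edist_zero_right, ← ofReal_norm,
      ENNReal.ofReal_lt_ofReal_iff hr] at hy
    exact hy.le
  have hpa : ∀ n, p n (fun _ => y) = ∫ u, F n u (fun _ => y) ∂ν := fun n =>
    ContinuousMultilinearMap.integral_apply (hFi n) _
  simp_rw [hpa]
  have hsum : ∀ u, HasSum (fun n : ℕ => Real.exp (ℓ u s).re * ((r * ‖ℓ u‖) ^ n / (n.factorial : ℝ)))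
      (Real.exp ((ℓ u s).re + r * ‖ℓ u‖)) := fun u => by
    rw [Real.exp_add]
    refine HasSum.mul_left _ ?_
    rw [Real.exp_eq_exp_ℝ]
    exact NormedSpace.expSeries_div_hasSum_exp (r * ‖ℓ u‖)
  -- The dominating terms are those of the exponential series of `r * ‖ℓ u‖`, whose sum is the
  -- integrable function of `hint`.
  refine hasSum_integral_of_dominated_convergence
    (fun n u => Real.exp (ℓ u s).re * ((r * ‖ℓ u‖) ^ n / (n.factorial : ℝ)))
    (fun n => (ContinuousMultilinearMap.apply ℂ (fun _ : Fin n => E) ℂ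
      (fun _ => y)).continuous.comp_aestronglyMeasurable (hFm n))
    (fun n => ae_of_all _ fun u => ?_) (ae_of_all _ fun u => (hsum u).summable) ?_
    (ae_of_all _ fun u => ?_)
  · simp only [hF, smul_apply, expFormSeries_apply, norm_smul,
      Complex.norm_exp, norm_div, norm_pow, RCLike.norm_natCast]
    gcongr
    calc ‖ℓ u y‖ ≤ ‖ℓ u‖ * ‖y‖ := (ℓ u).le_opNorm y
      _ ≤ r * ‖ℓ u‖ := by rw [mul_comm]; gcongr
  · exact hint.congr (ae_of_all _ fun u => (hsum u).tsum_eq.symm)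
  · simp only [hF, smul_apply, expFormSeries_apply, smul_eq_mul, map_add,
      Complex.exp_add]
    refine HasSum.mul_left _ ?_
    rw [Complex.exp_eq_exp_ℂ]
    exact NormedSpace.expSeries_div_hasSum_exp (ℓ u y)

end Analytic

/-! ### Landau's theorem and exponential moments -/

section Landau

variable {Ω : Type*} [MeasurableSpace Ω] {P : Measure Ω}

lemma integrable_exp_mul_of_nonpos [IsFiniteMeasure P] {X : Ω → ℝ} (hX : AEMeasurable X P)
    (hX0 : ∀ᵐ ω ∂P, 0 ≤ X ω) {x : ℝ} (hx : x ≤ 0) :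
    Integrable (fun ω => Real.exp (x * X ω)) P := by
  refine Integrable.of_bound (C := 1) (by fun_prop) ?_
  filter_upwards [hX0] with ω h
  rw [Real.norm_eq_abs, Real.abs_exp, Real.exp_le_one_iff]
  exact mul_nonpos_of_nonpos_of_nonneg hx h

/-- Landau's theorem for nonnegative random variables: if the Laplace transform extends
analytically to `Re s > a`, then it converges there. -/
theorem integrable_exp_of_extendsAnalytically [IsFiniteMeasure P] {X : Ω → ℝ}
    (hX : AEMeasurable X P) (hX0 : ∀ᵐ ω ∂P, 0 ≤ X ω) {a : ℝ}
    (h : ExtendsAnalytically (laplaceRV P X) closedHalfPlane {s : ℂ | a < s.re})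
    {x : ℝ} (hx : x < -a) : Integrable (fun ω => Real.exp (x * X ω)) P := by
  rcases le_or_gt x 0 with hx0 | hx0
  · exact integrable_exp_mul_of_nonpos hX hX0 hx0
  obtain ⟨-, g, hg, hgL⟩ := h
  have hset : Iio (0 : ℝ) ⊆ integrableExpSet X P := fun t ht =>
    integrable_exp_mul_of_nonpos hX hX0 (le_of_lt ht)
  have hint : (-1 : ℂ).re ∈ interior (integrableExpSet X P) :=
    interior_mono hset (by rw [isOpen_Iio.interior_eq]; simp)
  set f : ℂ → ℂ := fun z => g (-z) with hf
  -- The disc centred at -1 with radius `1 - a` meets the real axis up to `-a`, so it contains `x`.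
  -- The centre lies inside the half-plane where the moment generating function is known to
  -- converge.
  have hfd : DifferentiableOn ℂ f (Metric.ball (-1) (1 - a)) := by
    intro z hz
    have hre : |z.re + 1| < 1 - a := by
      refine lt_of_le_of_lt ?_ (mem_ball_iff_norm.1 hz)
      simpa using Complex.abs_re_le_norm (z - -1)
    have : a < (-z).re := by
      rw [Complex.neg_re]; linarith [(abs_lt.1 hre).2]
    exact ((hg _ this).differentiableAt.comp z differentiable_neg.differentiableAt).differentiableWithinAt
  have hfe : f =ᶠ[𝓝 (-1)] complexMGF X P := by
    have ho : IsOpen {z : ℂ | z.re < 0} := isOpen_lt Complex.continuous_re continuous_const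
    filter_upwards [ho.mem_nhds (show (-1 : ℂ) ∈ {z : ℂ | z.re < 0} by simp)] with z hz
    have : (-z) ∈ closedHalfPlane := by
      simp only [closedHalfPlane, mem_ofPred_eq, Complex.neg_re] at hz ⊢; linarith
    rw [hf]
    simp only
    rw [hgL this]
    simp [laplaceRV, complexMGF]
  have hxball : (x : ℂ) ∈ Metric.ball (-1 : ℂ) (1 - a) := by
    rw [mem_ball_iff_norm, sub_neg_eq_add, ← Complex.ofReal_one, ← Complex.ofReal_add,
      Complex.norm_real, Real.norm_eq_abs, abs_of_pos (by linarith)]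
    linarith
  have hsum := (Complex.hasSum_taylorSeries_on_ball hfd hxball).summable
  -- The Taylor coefficients at -1 are moments of `X` weighted by `exp (-X)`, and `x + 1 > 0`: every
  -- term of the convergent series is nonnegative.
  have hterm : ∀ n : ℕ, ((n.factorial : ℂ)⁻¹ • ((x : ℂ) - -1) ^ n • iteratedDeriv n f (-1)) =
      ((∫ ω, ((x + 1) * X ω) ^ n / (n.factorial : ℝ) * Real.exp (-X ω) ∂P : ℝ) : ℂ) := fun n => by
    rw [hfe.iteratedDeriv_eq, iteratedDeriv_complexMGF hint, ← integral_complex_ofReal,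
      smul_eq_mul, smul_eq_mul, ← mul_assoc, ← integral_const_mul]
    congr 1
    ext ω
    push_cast
    rw [mul_pow, sub_neg_eq_add, neg_one_mul]
    ring
  simp_rw [hterm] at hsum
  have hsum' : Summable fun n : ℕ =>
      ∫ ω, ((x + 1) * X ω) ^ n / (n.factorial : ℝ) * Real.exp (-X ω) ∂P := by
    exact_mod_cast hsum
  have hti : ∀ n : ℕ, Integrable
      (fun ω => ((x + 1) * X ω) ^ n / (n.factorial : ℝ) * Real.exp (-X ω)) P := fun n => by
    have h1 := (integrable_pow_mul_exp_of_mem_interior_integrableExpSet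
      (X := X) (μ := P) (v := -1) (by simpa using hint) n).const_mul
      ((x + 1) ^ n / (n.factorial : ℝ))
    refine h1.congr (ae_of_all _ fun ω => ?_)
    simp only [neg_one_mul]
    rw [mul_pow]; ring
  refine ⟨by fun_prop, ?_⟩
  rw [hasFiniteIntegral_iff_ofReal (ae_of_all _ fun _ => (Real.exp_pos _).le)]
  -- Expanding `exp ((x + 1) * X) * exp (-X)` in nonnegative terms, Tonelli identifies the
  -- expectation with the convergent Taylor sum.
  have key : ∀ᵐ ω ∂P, ENNReal.ofReal (Real.exp (x * X ω)) =
      ∑' n : ℕ, ENNReal.ofReal (((x + 1) * X ω) ^ n / (n.factorial : ℝ) * Real.exp (-X ω)) := by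
    filter_upwards [hX0] with ω hω
    have hs : HasSum (fun n : ℕ => ((x + 1) * X ω) ^ n / (n.factorial : ℝ) * Real.exp (-X ω))
        (Real.exp (x * X ω)) := by
      have : Real.exp (x * X ω) = Real.exp ((x + 1) * X ω) * Real.exp (-X ω) := by
        rw [← Real.exp_add]; ring_nf
      rw [this, Real.exp_eq_exp_ℝ]
      exact (NormedSpace.expSeries_div_hasSum_exp ((x + 1) * X ω)).mul_right _
    rw [← hs.tsum_eq, ENNReal.ofReal_tsum_of_nonneg (fun n => by positivity) hs.summable]
  rw [lintegral_congr_ae key, lintegral_tsum fun n => (hti n).aemeasurable.ennreal_ofReal]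
  have hn : ∀ n : ℕ,
      ∫⁻ ω, ENNReal.ofReal (((x + 1) * X ω) ^ n / (n.factorial : ℝ) * Real.exp (-X ω)) ∂P =
      ENNReal.ofReal (∫ ω, ((x + 1) * X ω) ^ n / (n.factorial : ℝ) * Real.exp (-X ω) ∂P) := fun n => by
    rw [ofReal_integral_eq_lintegral_ofReal (hti n)]
    filter_upwards [hX0] with ω hω
    positivity
  simp_rw [hn]
  rw [← ENNReal.ofReal_tsum_of_nonneg _ hsum']
  · exact ENNReal.ofReal_lt_top
  · intro n
    refine integral_nonneg_of_ae ?_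
    filter_upwards [hX0] with ω hω
    simp only [Pi.zero_apply]
    positivity

end Landau

/-! ### Stochastic domination by a limit in distribution -/

section StochasticOrder

variable {Ω Ω' : Type*} [MeasurableSpace Ω] [MeasurableSpace Ω'] {P : Measure Ω}
  [IsProbabilityMeasure P] {P' : Measure Ω'} [IsProbabilityMeasure P']

lemma tendsto_integral_of_tendstoInDistribution {V : ℝ → Ω → ℝ} {Z : Ω' → ℝ}
    (hV : TendstoInDistribution V atTop Z (fun _ => P) P') (f : BoundedContinuousFunction ℝ ℝ) :
    Tendsto (fun t => ∫ ω, f (V t ω) ∂P) atTop (𝓝 (∫ ω, f (Z ω) ∂P')) := by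
  have h := ProbabilityMeasure.tendsto_iff_forall_integral_tendsto.1 hV.tendsto f
  simp only [ProbabilityMeasure.coe_mk] at h
  rw [integral_map hV.aemeasurable_limit f.continuous.aestronglyMeasurable] at h
  refine h.congr fun t => ?_
  rw [integral_map (hV.forall_aemeasurable t) f.continuous.aestronglyMeasurable]

lemma nonneg_of_tendstoInDistribution {V : ℝ → Ω → ℝ} {Z : Ω' → ℝ}
    (hV : TendstoInDistribution V atTop Z (fun _ => P) P')
    (h0 : ∀ᵐ ω ∂P, ∀ t, 0 ≤ t → 0 ≤ V t ω) : ∀ᵐ ω ∂P', 0 ≤ Z ω := by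
  -- A bounded continuous test function that is positive exactly on the negative reals.
  set f : BoundedContinuousFunction ℝ ℝ := BoundedContinuousFunction.ofNormedAddCommGroup
    (fun x : ℝ => min 1 (max 0 (-x))) (by fun_prop) 1 (fun x => by
      rw [Real.norm_eq_abs, abs_of_nonneg (by positivity)]; exact min_le_left _ _) with hf
  have hlim := tendsto_integral_of_tendstoInDistribution hV f
  have hz : (fun t => ∫ ω, f (V t ω) ∂P) =ᶠ[atTop] fun _ => 0 := by
    filter_upwards [eventually_ge_atTop 0] with t ht
    refine integral_eq_zero_of_ae ?_
    filter_upwards [h0] with ω hω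
    simp [hf, hω t ht]
  have h1 : ∫ ω, f (Z ω) ∂P' = 0 := tendsto_nhds_unique hlim (tendsto_const_nhds.congr' hz.symm)
  have hfn : ∀ x, 0 ≤ f x := fun x => by simp [hf]
  rw [integral_eq_zero_iff_of_nonneg (fun ω => hfn _)] at h1
  · filter_upwards [h1] with ω hω
    by_contra hneg
    have : 0 < f (Z ω) := by
      simp only [hf, BoundedContinuousFunction.coe_ofNormedAddCommGroup]
      exact lt_min one_pos (lt_max_of_lt_right (by linarith))
    simp only [Pi.zero_apply] at hω
    linarith
  · exact Integrable.of_bound (C := ‖f‖)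
      (f.continuous.comp_aestronglyMeasurable hV.aemeasurable_limit.aestronglyMeasurable)
      (ae_of_all _ fun ω => f.norm_coe_le_norm _)

/-- A stationary process that is eventually below a process converging in distribution is
stochastically dominated by the limit. -/
theorem integral_le_of_eventually_le {U V : ℝ → Ω → ℝ} {ν : Measure ℝ} {Z : Ω' → ℝ}
    (hU : ∀ t, 0 ≤ t → HasLaw (U t) ν P)
    (hV : TendstoInDistribution V atTop Z (fun _ => P) P')
    (hle : ∀ᵐ ω ∂P, ∀ᶠ t in atTop, U t ω ≤ V t ω)
    (f : BoundedContinuousFunction ℝ ℝ) (hf : Monotone f) :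
    ∫ x, f x ∂ν ≤ ∫ ω, f (Z ω) ∂P' := by
  have hlim := (tendsto_integral_of_tendstoInDistribution hV f).comp tendsto_natCast_atTop_atTop
  have hUm : ∀ n : ℕ, AEStronglyMeasurable (fun ω => f (U n ω)) P := fun n =>
    f.continuous.comp_aestronglyMeasurable (hU n n.cast_nonneg).aemeasurable.aestronglyMeasurable
  have hVm : ∀ n : ℕ, AEStronglyMeasurable (fun ω => f (V n ω)) P := fun n =>
    f.continuous.comp_aestronglyMeasurable (hV.forall_aemeasurable n).aestronglyMeasurable
  have hUi : ∀ n : ℕ, Integrable (fun ω => f (U n ω)) P := fun n =>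
    Integrable.of_bound (C := ‖f‖) (hUm n) (ae_of_all _ fun ω => f.norm_coe_le_norm _)
  have hVi : ∀ n : ℕ, Integrable (fun ω => f (V n ω)) P := fun n =>
    Integrable.of_bound (C := ‖f‖) (hVm n) (ae_of_all _ fun ω => f.norm_coe_le_norm _)
  -- Almost surely the positive part of the difference is eventually zero, so its mean vanishes in
  -- the limit by dominated convergence. By stationarity the mean of `f (U n)` does not depend on
  -- `n`.
  have hdiff : Tendsto (fun n : ℕ => ∫ ω, max 0 (f (U n ω) - f (V n ω)) ∂P) atTop
      (𝓝 (∫ _, (0 : ℝ) ∂P)) := by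
    refine tendsto_integral_of_dominated_convergence (fun _ => 2 * ‖f‖)
      (fun n => (aestronglyMeasurable_const.sup ((hUm n).sub (hVm n))))
      (integrable_const _) (fun n => ae_of_all _ fun ω => ?_) ?_
    · rw [Real.norm_eq_abs, abs_of_nonneg (le_max_left _ _)]
      refine max_le (by positivity) ?_
      have h1 := (abs_le.1 (f.norm_coe_le_norm (U n ω))).2
      have h2 := (abs_le.1 (f.norm_coe_le_norm (V n ω))).1
      linarith
    · filter_upwards [hle] with ω hω
      refine tendsto_const_nhds.congr' ?_
      filter_upwards [tendsto_natCast_atTop_atTop.eventually hω] with n hn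
      rw [max_eq_left (sub_nonpos.2 (hf hn))]
  rw [integral_zero] at hdiff
  have hsum := hlim.add hdiff
  rw [add_zero] at hsum
  refine ge_of_tendsto' hsum fun n => ?_
  have hmi : Integrable (fun ω => max 0 (f (U n ω) - f (V n ω))) P :=
    (integrable_zero _ _ _).sup ((hUi n).sub (hVi n))
  rw [← (hU n n.cast_nonneg).integral_comp f.continuous.aestronglyMeasurable]
  simp only [Function.comp_def]
  rw [← integral_add (hVi n) hmi]
  refine integral_mono (hUi n) ((hVi n).add hmi) fun ω => ?_
  linarith [le_max_right 0 (f (U n ω) - f (V n ω))]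

/-- The exponential is the increasing limit of its truncations at `n`, which are bounded, continuous
and monotone; monotone convergence passes the domination to the limit. -/
theorem lintegral_exp_le_of_eventually_le {U V : ℝ → Ω → ℝ} {ν : Measure ℝ} {Z : Ω' → ℝ}
    (hU : ∀ t, 0 ≤ t → HasLaw (U t) ν P)
    (hV : TendstoInDistribution V atTop Z (fun _ => P) P')
    (hle : ∀ᵐ ω ∂P, ∀ᶠ t in atTop, U t ω ≤ V t ω) {θ : ℝ} (hθ : 0 ≤ θ) :
    ∫⁻ x, ENNReal.ofReal (Real.exp (θ * x)) ∂ν ≤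
      ∫⁻ ω, ENNReal.ofReal (Real.exp (θ * Z ω)) ∂P' := by
  have : IsProbabilityMeasure ν := (hU 0 le_rfl).isProbabilityMeasure_iff.1 inferInstance
  have hsup : ∀ x : ℝ, ENNReal.ofReal (Real.exp (θ * x)) =
      ⨆ n : ℕ, ENNReal.ofReal (min (Real.exp (θ * x)) n) := fun x => by
    refine le_antisymm ?_ (iSup_le fun n => ENNReal.ofReal_le_ofReal (min_le_left _ _))
    obtain ⟨n, hn⟩ := exists_nat_ge (Real.exp (θ * x))
    exact le_iSup_of_le n (by rw [min_eq_left hn])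
  rw [lintegral_congr hsup, lintegral_iSup
    (f := fun (n : ℕ) x => ENNReal.ofReal (min (Real.exp (θ * x)) n)) (fun n => by fun_prop)
    (fun m n hmn x => ENNReal.ofReal_le_ofReal (min_le_min_left _ (Nat.cast_le.2 hmn)))]
  refine iSup_le fun n => ?_
  set f : BoundedContinuousFunction ℝ ℝ := BoundedContinuousFunction.ofNormedAddCommGroup
    (fun x : ℝ => min (Real.exp (θ * x)) n) (by fun_prop) n (fun x => by
      rw [Real.norm_eq_abs, abs_of_nonneg (by positivity)]; exact min_le_right _ _) with hf
  have hfm : Monotone f := fun x y hxy => by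
    simp only [hf, BoundedContinuousFunction.coe_ofNormedAddCommGroup]
    gcongr
  have hfn : ∀ x, 0 ≤ f x := fun x => by
    simp only [hf, BoundedContinuousFunction.coe_ofNormedAddCommGroup]
    positivity
  have h := ENNReal.ofReal_le_ofReal (integral_le_of_eventually_le hU hV hle f hfm)
  rw [ofReal_integral_eq_lintegral_ofReal (f.integrable ν) (ae_of_all _ hfn),
    ofReal_integral_eq_lintegral_ofReal _ (ae_of_all _ fun _ => hfn _)] at h
  · refine h.trans (lintegral_mono fun ω => ENNReal.ofReal_le_ofReal (min_le_left _ _))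
  · exact Integrable.of_bound (C := ‖f‖)
      (f.continuous.comp_aestronglyMeasurable hV.aemeasurable_limit.aestronglyMeasurable)
      (ae_of_all _ fun ω => f.norm_coe_le_norm _)

end StochasticOrder

/-! ### Mean of the exponential distribution -/

section Exponential

lemma expMeasure_eq_withDensity (r : ℝ) : expMeasure r =
    (volume.restrict (Ioi 0)).withDensity fun x => ENNReal.ofReal (r * Real.exp (-(r * x))) := by
  rw [← withDensity_indicator measurableSet_Ioi, expMeasure, gammaMeasure]
  refine withDensity_congr_ae ?_
  filter_upwards [Measure.ae_ne volume (0 : ℝ)] with x hx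
  rcases lt_or_gt_of_ne hx with h | h
  · rw [gammaPDF_of_neg h, indicator_of_notMem (by simpa using h.le)]
  · rw [gammaPDF_of_nonneg h.le, indicator_of_mem (by simpa using h)]
    simp

lemma ae_nonneg_expMeasure (r : ℝ) : ∀ᵐ x ∂expMeasure r, 0 ≤ x := by
  rw [expMeasure_eq_withDensity]
  refine (withDensity_absolutelyContinuous _ _).ae_le ?_
  filter_upwards [ae_restrict_mem measurableSet_Ioi] with x hx using le_of_lt hx

lemma integrable_id_expMeasure {r : ℝ} (hr : 0 < r) : Integrable (fun x : ℝ => x) (expMeasure r) := by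
  rw [expMeasure_eq_withDensity, integrable_withDensity_iff_integrable_smul' (by fun_prop)
    (ae_of_all _ fun _ => ENNReal.ofReal_lt_top)]
  have h := (integrableOn_rpow_mul_exp_neg_mul_rpow (p := 1) (s := 1) (by norm_num) one_pos
    hr).const_mul r
  refine h.congr (ae_of_all _ fun x => ?_)
  simp only [Real.rpow_one, smul_eq_mul]
  rw [ENNReal.toReal_ofReal (by positivity)]
  ring_nf

lemma integral_id_expMeasure {r : ℝ} (hr : 0 < r) : ∫ x, x ∂expMeasure r = 1 / r := by
  rw [expMeasure_eq_withDensity, integral_withDensity_eq_integral_toReal_smul (by fun_prop)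
    (ae_of_all _ fun _ => ENNReal.ofReal_lt_top)]
  have h := Real.integral_rpow_mul_exp_neg_mul_Ioi (a := 2) two_pos hr
  rw [Real.Gamma_two, mul_one, show (2 : ℝ) - 1 = 1 by norm_num] at h
  calc _ = ∫ x in Ioi (0 : ℝ), r * (x ^ (1 : ℝ) * Real.exp (-(r * x))) := by
        congr 1
        ext x
        rw [ENNReal.toReal_ofReal (by positivity), Real.rpow_one, smul_eq_mul]
        ring
    _ = _ := by
        rw [integral_const_mul, h, Real.rpow_two]
        field_simp

end Exponential

/-! ### Linear bound on the work brought to a queue -/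

section Work

variable {Ω : Type*}

lemma arrivalTime_lt_of_arrivalCount {τ : ℕ → Ω → ℝ} {ω : Ω} (hτ : ∀ n, 0 ≤ τ n ω) {t : ℝ} {n : ℕ}
    (h : arrivalCount τ t ω = n + 1) : arrivalTime τ n ω < t := by
  have hmono : Monotone fun n => arrivalTime τ n ω := monotone_nat_of_le_succ fun n => by
    simp only [arrivalTime]
    rw [Finset.sum_range_succ _ (n + 1)]
    linarith [hτ (n + 1)]
  by_contra! hn
  have hsub : {k : ℕ | arrivalTime τ k ω < t} ⊆ Iio n := fun k hk => by
    by_contra hkn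
    exact absurd (hn.trans (hmono (not_lt.1 hkn))) (not_le.2 hk)
  have hc := Set.ncard_le_ncard hsub (Set.finite_Iio n)
  rw [show {k : ℕ | arrivalTime τ k ω < t}.ncard = n + 1 from h] at hc
  rw [← Finset.coe_Iio, Set.ncard_coe_finset, Nat.card_Iio] at hc
  omega

/-- From some index `N` on, the averages make the total service time at most `r` times the sum of
the interarrival times. The latter sum is the epoch of the last job counted, hence less than `t`.
The first `N` services make up the constant. -/
lemma exists_work_le {τ T : ℕ → Ω → ℝ} {ω : Ω} (hτ : ∀ n, 0 ≤ τ n ω) (hT : ∀ n, 0 ≤ T n ω)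
    {m q r : ℝ} (hr : 0 ≤ r) (hqr : q < r * m)
    (hm : Tendsto (fun n : ℕ => (∑ k ∈ Finset.range n, τ k ω) / n) atTop (𝓝 m))
    (hq : Tendsto (fun n : ℕ => (∑ k ∈ Finset.range n, T k ω) / n) atTop (𝓝 q)) :
    ∃ C, ∀ t, 0 ≤ t → work τ T t ω ≤ C + r * t := by
  have hlim := hq.sub (hm.const_mul r)
  obtain ⟨N, hN⟩ := eventually_atTop.1 (hlim.eventually_lt_const (sub_neg.2 hqr))
  have hQ : ∀ n, N ≤ n → ∑ k ∈ Finset.range n, T k ω ≤ r * ∑ k ∈ Finset.range n, τ k ω := by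
    intro n hn
    rcases Nat.eq_zero_or_pos n with rfl | hpos
    · simp
    have h := hN n hn
    rw [← mul_div_assoc, ← sub_div, div_lt_iff₀ (by exact_mod_cast hpos), zero_mul] at h
    linarith
  refine ⟨∑ k ∈ Finset.range N, T k ω, fun t ht => ?_⟩
  have hC : 0 ≤ ∑ k ∈ Finset.range N, T k ω := Finset.sum_nonneg fun k _ => hT k
  have hrt : 0 ≤ r * t := mul_nonneg hr ht
  unfold work
  rcases le_total (arrivalCount τ t ω) N with hle | hle
  · have := Finset.sum_le_sum_of_subset_of_nonneg (Finset.range_mono hle)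
      (f := fun k => T k ω) fun k _ _ => hT k
    linarith
  · refine (hQ _ hle).trans ?_
    obtain h0 | ⟨n, hn⟩ : arrivalCount τ t ω = 0 ∨ ∃ n, arrivalCount τ t ω = n + 1 := by
      cases arrivalCount τ t ω <;> simp
    · rw [h0]; simp only [Finset.range_zero, Finset.sum_empty, mul_zero]; linarith
    · have := mul_le_mul_of_nonneg_left (arrivalTime_lt_of_arrivalCount hτ hn).le hr
      unfold arrivalTime at this
      rw [hn]; linarith

variable [MeasurableSpace Ω] {P : Measure Ω}

/-- Strong law of large numbers for the work brought to queue `j`. -/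
theorem IsArrivalModel.exists_work_le {lam mu : Fin 2 → ℝ} {B : Fin 2 → Measure ℝ}
    {τ T : Fin 2 → ℕ → Ω → ℝ} (hA : IsArrivalModel P lam B τ T) (j : Fin 2)
    (hB : IsServiceLaw (B j) (mu j)) {r : ℝ} (hr : lam j / mu j < r) :
    ∀ᵐ ω ∂P, ∃ C, ∀ t, 0 ≤ t → work (τ j) (T j) t ω ≤ C + r * t := by
  have hlam := hA.rate_pos j
  have hmu := hB.rate_pos
  have hτ0 : ∀ᵐ ω ∂P, ∀ n, 0 ≤ τ j n ω := ae_all_iff.2 fun n =>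
    ae_of_ae_map (hA.interarrival_law j n).aemeasurable (by
      rw [(hA.interarrival_law j n).map_eq]; exact ae_nonneg_expMeasure _)
  have hT0 : ∀ᵐ ω ∂P, ∀ n, 0 ≤ T j n ω := ae_all_iff.2 fun n =>
    ae_of_ae_map (hA.service_law j n).aemeasurable (by
      rw [(hA.service_law j n).map_eq]
      refine measure_mono_null (fun x hx => ?_) hB.pos
      exact le_of_lt (by simpa using hx))
  have hτi : Integrable (τ j 0) P := by
    have := integrable_id_expMeasure hlam
    rw [← (hA.interarrival_law j 0).map_eq] at this
    exact (integrable_map_measure (by fun_prop) (hA.interarrival_law j 0).aemeasurable).1 this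
  have hTi : Integrable (T j 0) P := by
    have := hB.integrable
    rw [← (hA.service_law j 0).map_eq] at this
    exact (integrable_map_measure (by fun_prop) (hA.service_law j 0).aemeasurable).1 this
  have hτ := strong_law_ae_real (fun n => τ j n) hτi
    (fun m n hmn => hA.indep.indepFun (i := Sum.inl (j, m)) (j := Sum.inl (j, n)) (by simpa using hmn))
    (fun n => ⟨(hA.interarrival_law j n).aemeasurable, (hA.interarrival_law j 0).aemeasurable, by
      rw [(hA.interarrival_law j n).map_eq, (hA.interarrival_law j 0).map_eq]⟩)
  have hT := strong_law_ae_real (fun n => T j n) hTi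
    (fun m n hmn => hA.indep.indepFun (i := Sum.inr (j, m)) (j := Sum.inr (j, n)) (by simpa using hmn))
    (fun n => ⟨(hA.service_law j n).aemeasurable, (hA.service_law j 0).aemeasurable, by
      rw [(hA.service_law j n).map_eq, (hA.service_law j 0).map_eq]⟩)
  rw [(hA.interarrival_law j 0).integral_eq, integral_id_expMeasure hlam] at hτ
  rw [(hA.service_law j 0).integral_eq, hB.mean] at hT
  filter_upwards [hτ0, hT0, hτ, hT] with ω h1 h2 h3 h4
  refine SQF.exists_work_le h1 h2 ((by positivity : (0 : ℝ) ≤ lam j / mu j).trans hr.le) ?_ h3 h4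
  rw [mul_one_div, lt_div_iff₀ hlam, one_div_mul_eq_div]
  exact hr

end Work

/-! ### Comparison and emptying of workload paths -/

section Paths

variable {X Y a b w : ℝ → ℝ} {x y : ℝ}

/-- Comparison of two workload paths with the same input. -/
theorem le_of_rate_le (ha : ∀ t, 0 ≤ t → IntervalIntegrable a volume 0 t)
    (hb : ∀ t, 0 ≤ t → IntervalIntegrable b volume 0 t)
    (hX : ∀ t, 0 ≤ t → X t = x + w t - ∫ s in (0 : ℝ)..t, a s)
    (hY : ∀ t, 0 ≤ t → Y t = y + w t - ∫ s in (0 : ℝ)..t, b s)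
    (hab : ∀ t, 0 ≤ t → X t < Y t → a t ≤ b t) {t₀ : ℝ} (ht₀ : 0 ≤ t₀) (h₀ : Y t₀ ≤ X t₀)
    {t : ℝ} (ht : t₀ ≤ t) : Y t ≤ X t := by
  by_contra! hlt
  -- The common input `w` cancels in the difference, which is therefore continuous although both
  -- paths may jump.
  set D : ℝ → ℝ := fun u => x - y - ∫ s in (0 : ℝ)..u, (a s - b s) with hD
  have hDe : ∀ u, 0 ≤ u → X u - Y u = D u := fun u hu => by
    rw [hX u hu, hY u hu, hD]
    simp only
    rw [intervalIntegral.integral_sub (ha u hu) (hb u hu)]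
    ring
  have ht0 : 0 ≤ t := ht₀.trans ht
  have hi : ∀ u, 0 ≤ u → IntervalIntegrable (fun s => a s - b s) volume 0 u := fun u hu =>
    (ha u hu).sub (hb u hu)
  have hcont : ContinuousOn D (Icc t₀ t) := by
    have h := intervalIntegral.continuousOn_primitive_interval (a := (0 : ℝ)) (b := t)
      (f := fun s => a s - b s) (μ := volume) (by
        rw [uIcc_of_le ht0, integrableOn_Icc_iff_integrableOn_Ioc]
        exact (intervalIntegrable_iff_integrableOn_Ioc_of_le ht0).1 (hi t ht0))
    rw [uIcc_of_le ht0] at h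
    exact continuousOn_const.sub (h.mono (Icc_subset_Icc_left ht₀))
  have hS : IsCompact (Icc t₀ t ∩ D ⁻¹' Ici 0) :=
    isCompact_Icc.of_isClosed_subset (hcont.preimage_isClosed_of_isClosed isClosed_Icc isClosed_Ici)
      inter_subset_left
  have hne : (Icc t₀ t ∩ D ⁻¹' Ici 0).Nonempty :=
    ⟨t₀, left_mem_Icc.2 ht, by
      simp only [mem_preimage, mem_Ici]; rw [← hDe t₀ ht₀]; linarith⟩
  -- `s` is the last time up to `t` with `D ≥ 0`. After it `X < Y`, so `a ≤ b` and `D` cannot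
  -- decrease, contradicting `D t < 0`.
  obtain ⟨s, ⟨⟨hs1, hs2⟩, hs3⟩, hsmax⟩ := hS.exists_isGreatest hne
  have hs0 : 0 ≤ s := ht₀.trans hs1
  simp only [mem_preimage, mem_Ici] at hs3
  have hint : D t - D s = -∫ u in s..t, (a u - b u) := by
    rw [← intervalIntegral.integral_interval_sub_left (hi t ht0) (hi s hs0)]
    simp only [hD]; ring
  have hle : ∫ u in s..t, (a u - b u) ≤ 0 := by
    rw [intervalIntegral.integral_of_le hs2]
    refine setIntegral_nonpos measurableSet_Ioc fun u hu => ?_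
    have hu0 : 0 ≤ u := hs0.trans hu.1.le
    have hDu : D u < 0 := by
      by_contra! hneg
      exact absurd (hsmax ⟨⟨hs1.trans hu.1.le, hu.2⟩, hneg⟩) (not_le.2 hu.1)
    rw [← hDe u hu0] at hDu
    linarith [hab u hu0 (by linarith)]
  have := hDe t ht0
  linarith

/-- A stable queue served at unit rate while non-empty becomes empty. -/
theorem exists_nonpos_of_rate_eq_one
    (hX : ∀ t, 0 ≤ t → X t = x + w t - ∫ s in (0 : ℝ)..t, a s)
    (ha : ∀ t, 0 ≤ t → 0 < X t → a t = 1) {C r : ℝ} (hr : r < 1)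
    (hw : ∀ t, 0 ≤ t → w t ≤ C + r * t) : ∃ t, 0 ≤ t ∧ X t ≤ 0 := by
  by_contra! hpos
  -- If the queue never empties, then `X t ≤ x + C - (1 - r) * t`, and this is nonpositive from here
  -- on.
  set t := max 0 ((x + C) / (1 - r)) with ht
  have ht0 : 0 ≤ t := le_max_left _ _
  have hint : ∫ s in (0 : ℝ)..t, a s = t := by
    rw [intervalIntegral.integral_congr (g := fun _ => (1 : ℝ))]
    · simp
    · intro s hs
      rw [uIcc_of_le ht0] at hs
      exact ha s hs.1 (hpos s hs.1)
  have h1 := hX t ht0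
  rw [hint] at h1
  have h2 := hw t ht0
  have h3 : x + C ≤ t * (1 - r) := by
    rw [← div_le_iff₀ (by linarith)]; exact le_max_right _ _
  linarith [hpos t ht0]

end Paths

/-! ### Service rates of SQF and HoL -/

section Policies

variable {u : ℝ × ℝ}

/-- Work conservation. With the bound of each rate by 1, it is all that the domination uses of SQF;
the choice of the shorter queue plays no role. -/
lemma sqf_add_eq_one (h₁ : 0 ≤ u.1) (h₂ : 0 ≤ u.2) (h : 0 < u.1 + u.2) :
    (sqf u).1 + (sqf u).2 = 1 := by
  unfold sqf
  split_ifs <;> grind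

lemma sqf_le_one (u : ℝ × ℝ) : (sqf u).1 ≤ 1 ∧ (sqf u).2 ≤ 1 := by
  unfold sqf
  constructor <;> split_ifs <;> grind

lemma hol₁_add_le_one (u : ℝ × ℝ) : (hol₁ u).1 + (hol₁ u).2 ≤ 1 := by
  unfold hol₁
  split_ifs <;> grind

lemma hol₂_add_le_one (u : ℝ × ℝ) : (hol₂ u).1 + (hol₂ u).2 ≤ 1 := by
  unfold hol₂
  split_ifs <;> grind

lemma hol₁_eq_one (h : 0 < u.1) : (hol₁ u).1 = 1 := if_pos h

lemma hol₂_eq_one (h : 0 < u.2) : (hol₂ u).2 = 1 := if_pos h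

end Policies

/-! ### Domination of SQF by HoL -/

section Domination

/-- Pathwise comparison of two workload paths with the same input in a two-queue system: a queue
with low priority eventually carries at least the workload it has under another work-conserving
policy. -/
theorem eventually_le_of_priority {U₁ U₂ V₁ V₂ p₁ p₂ q₁ q₂ w₁ w₂ : ℝ → ℝ} {C₁ C₂ r₁ r₂ : ℝ}
    (hr₁ : r₁ < 1) (hr : r₁ + r₂ < 1)
    (hw₁ : ∀ t, 0 ≤ t → w₁ t ≤ C₁ + r₁ * t) (hw₂ : ∀ t, 0 ≤ t → w₂ t ≤ C₂ + r₂ * t)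
    (hU0 : ∀ t, 0 ≤ t → 0 ≤ U₁ t) (hV0 : ∀ t, 0 ≤ t → 0 ≤ V₁ t ∧ 0 ≤ V₂ t)
    (hp₁i : ∀ t, 0 ≤ t → IntervalIntegrable p₁ volume 0 t)
    (hp₂i : ∀ t, 0 ≤ t → IntervalIntegrable p₂ volume 0 t)
    (hq₁i : ∀ t, 0 ≤ t → IntervalIntegrable q₁ volume 0 t)
    (hq₂i : ∀ t, 0 ≤ t → IntervalIntegrable q₂ volume 0 t)
    (hU₁ : ∀ t, 0 ≤ t → U₁ t = U₁ 0 + w₁ t - ∫ s in (0 : ℝ)..t, p₁ s)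
    (hU₂ : ∀ t, 0 ≤ t → U₂ t = U₂ 0 + w₂ t - ∫ s in (0 : ℝ)..t, p₂ s)
    (hV₁ : ∀ t, 0 ≤ t → V₁ t = V₁ 0 + w₁ t - ∫ s in (0 : ℝ)..t, q₁ s)
    (hV₂ : ∀ t, 0 ≤ t → V₂ t = V₂ 0 + w₂ t - ∫ s in (0 : ℝ)..t, q₂ s)
    (hp : ∀ t, 0 ≤ t → 0 < U₁ t + U₂ t → p₁ t + p₂ t = 1) (hp₁ : ∀ t, p₁ t ≤ 1)
    (hq : ∀ t, q₁ t + q₂ t ≤ 1) (hq₁ : ∀ t, 0 < V₁ t → q₁ t = 1) :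
    ∀ᶠ t in atTop, U₂ t ≤ V₂ t := by
  have hX : ∀ t, 0 ≤ t → (U₁ t + U₂ t) =
      (U₁ 0 + U₂ 0) + (w₁ t + w₂ t) - ∫ s in (0 : ℝ)..t, (p₁ s + p₂ s) := fun t ht => by
    rw [intervalIntegral.integral_add (hp₁i t ht) (hp₂i t ht), hU₁ t ht, hU₂ t ht]; ring
  have hY : ∀ t, 0 ≤ t → (V₁ t + V₂ t) =
      (V₁ 0 + V₂ 0) + (w₁ t + w₂ t) - ∫ s in (0 : ℝ)..t, (q₁ s + q₂ s) := fun t ht => by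
    rw [intervalIntegral.integral_add (hq₁i t ht) (hq₂i t ht), hV₁ t ht, hV₂ t ht]; ring
  -- At `t₁` the total `U` workload is zero, at `t₂` the priority queue of `V` is empty; each starts
  -- one of the two comparisons whatever the initial states.
  obtain ⟨t₁, ht₁, h₁⟩ := exists_nonpos_of_rate_eq_one (X := fun t => U₁ t + U₂ t)
    (C := C₁ + C₂) hX hp hr fun t ht => by linarith [hw₁ t ht, hw₂ t ht]
  obtain ⟨t₂, ht₂, h₂⟩ := exists_nonpos_of_rate_eq_one hV₁ (fun t _ => hq₁ t) hr₁ hw₁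
  filter_upwards [eventually_ge_atTop t₁, eventually_ge_atTop t₂] with t hle₁ hle₂
  -- When the `V` total is the smaller one, the `U` total is positive, so `U` is served at the full
  -- rate 1.
  have hXY : U₁ t + U₂ t ≤ V₁ t + V₂ t :=
    le_of_rate_le (X := fun t => V₁ t + V₂ t) (Y := fun t => U₁ t + U₂ t)
      (fun t ht => (hq₁i t ht).add (hq₂i t ht)) (fun t ht => (hp₁i t ht).add (hp₂i t ht)) hY hX
      (fun s hs hlt => by
        rw [hp s hs ((add_nonneg (hV0 s hs).1 (hV0 s hs).2).trans_lt hlt)]; exact hq s) ht₁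
      (h₁.trans (add_nonneg (hV0 t₁ ht₁).1 (hV0 t₁ ht₁).2)) hle₁
  have hVU : V₁ t ≤ U₁ t := le_of_rate_le hp₁i hq₁i hU₁ hV₁
    (fun s hs hlt => by rw [hq₁ s ((hU0 s hs).trans_lt hlt)]; exact hp₁ s) ht₂
    (h₂.trans (hU0 t₂ ht₂)) hle₂
  linarith

variable {Ω : Type*} [MeasurableSpace Ω] {P : Measure Ω}
  {lam mu : Fin 2 → ℝ} {B : Fin 2 → Measure ℝ} {τ T : Fin 2 → ℕ → Ω → ℝ} {U V : ℝ → Ω → ℝ × ℝ}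

lemma IsArrivalModel.exists_work_le_of_stable (hA : IsArrivalModel P lam B τ T)
    (hB : ∀ j, IsServiceLaw (B j) (mu j)) (hstable : lam 0 / mu 0 + lam 1 / mu 1 < 1) :
    ∃ r₀ r₁ : ℝ, r₀ < 1 ∧ r₁ < 1 ∧ r₀ + r₁ < 1 ∧ ∀ᵐ ω ∂P, ∃ C₀ C₁ : ℝ,
      (∀ t, 0 ≤ t → work (τ 0) (T 0) t ω ≤ C₀ + r₀ * t) ∧
      (∀ t, 0 ≤ t → work (τ 1) (T 1) t ω ≤ C₁ + r₁ * t) := by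
  have h0 : 0 < lam 0 / mu 0 := div_pos (hA.rate_pos 0) (hB 0).rate_pos
  have h1 : 0 < lam 1 / mu 1 := div_pos (hA.rate_pos 1) (hB 1).rate_pos
  -- A quarter of the spare capacity: raising both loads by `d` uses half of it, so the sum stays
  -- below 1.
  set d := (1 - lam 0 / mu 0 - lam 1 / mu 1) / 4 with hd
  have hd0 : 0 < d := by linarith
  refine ⟨lam 0 / mu 0 + d, lam 1 / mu 1 + d, by linarith, by linarith, by linarith, ?_⟩
  filter_upwards [hA.exists_work_le 0 (hB 0) (lt_add_of_pos_right _ hd0),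
    hA.exists_work_le 1 (hB 1) (lt_add_of_pos_right _ hd0)] with ω ⟨C₀, hC₀⟩ ⟨C₁, hC₁⟩
  exact ⟨C₀, C₁, hC₀, hC₁⟩

theorem eventually_snd_le_hol₁ (hA : IsArrivalModel P lam B τ T)
    (hB : ∀ j, IsServiceLaw (B j) (mu j)) (hstable : lam 0 / mu 0 + lam 1 / mu 1 < 1)
    (hU : IsWorkload P τ T sqf U) (hV : IsWorkload P τ T hol₁ V) :
    ∀ᵐ ω ∂P, ∀ᶠ t in atTop, (U t ω).2 ≤ (V t ω).2 := by
  obtain ⟨r₀, r₁, hr₀, -, hr, hw⟩ := hA.exists_work_le_of_stable hB hstable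
  filter_upwards [hw, hU.nonneg, hV.nonneg, hU.integrable, hV.integrable, hU.evolution,
    hV.evolution] with ω ⟨C₀, C₁, hw₀, hw₁⟩ hU0 hV0 hUi hVi hUe hVe
  exact eventually_le_of_priority hr₀ hr hw₀ hw₁ (fun t ht => (hU0 t ht).1) hV0
    (fun t ht => (hUi t ht).1) (fun t ht => (hUi t ht).2)
    (fun t ht => (hVi t ht).1) (fun t ht => (hVi t ht).2)
    (fun t ht => (hUe t ht).1) (fun t ht => (hUe t ht).2)
    (fun t ht => (hVe t ht).1) (fun t ht => (hVe t ht).2)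
    (fun t ht => sqf_add_eq_one (hU0 t ht).1 (hU0 t ht).2) (fun t => (sqf_le_one _).1)
    (fun t => hol₁_add_le_one _) (fun t => hol₁_eq_one)

theorem eventually_fst_le_hol₂ (hA : IsArrivalModel P lam B τ T)
    (hB : ∀ j, IsServiceLaw (B j) (mu j)) (hstable : lam 0 / mu 0 + lam 1 / mu 1 < 1)
    (hU : IsWorkload P τ T sqf U) (hV : IsWorkload P τ T hol₂ V) :
    ∀ᵐ ω ∂P, ∀ᶠ t in atTop, (U t ω).1 ≤ (V t ω).1 := by
  obtain ⟨r₀, r₁, -, hr₁, hr, hw⟩ := hA.exists_work_le_of_stable hB hstable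
  filter_upwards [hw, hU.nonneg, hV.nonneg, hU.integrable, hV.integrable, hU.evolution,
    hV.evolution] with ω ⟨C₀, C₁, hw₀, hw₁⟩ hU0 hV0 hUi hVi hUe hVe
  exact eventually_le_of_priority hr₁ (by linarith) hw₁ hw₀ (fun t ht => (hU0 t ht).2)
    (fun t ht => (hV0 t ht).symm)
    (fun t ht => (hUi t ht).2) (fun t ht => (hUi t ht).1)
    (fun t ht => (hVi t ht).2) (fun t ht => (hVi t ht).1)
    (fun t ht => (hUe t ht).2) (fun t ht => (hUe t ht).1)
    (fun t ht => (hVe t ht).2) (fun t ht => (hVe t ht).1)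
    (fun t ht h => by
      rw [add_comm]; exact sqf_add_eq_one (hU0 t ht).1 (hU0 t ht).2 (by rwa [add_comm]))
    (fun t => (sqf_le_one _).2)
    (fun t => by rw [add_comm]; exact hol₂_add_le_one _) (fun t => hol₂_eq_one)

variable {Ω' : Type*} [MeasurableSpace Ω'] [IsProbabilityMeasure P] {P' : Measure Ω'}
  [IsProbabilityMeasure P']

/-- Exponential moments of a stationary workload dominated by a convergent one. -/
theorem integrable_exp_of_eventually_le {X Y : ℝ → Ω → ℝ} {ν : Measure ℝ} {Z : Ω' → ℝ}
    (hX : ∀ t, 0 ≤ t → HasLaw (X t) ν P)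
    (hY : TendstoInDistribution Y atTop Z (fun _ => P) P')
    (hY0 : ∀ᵐ ω ∂P, ∀ t, 0 ≤ t → 0 ≤ Y t ω)
    (hle : ∀ᵐ ω ∂P, ∀ᶠ t in atTop, X t ω ≤ Y t ω) {a : ℝ}
    (h : ExtendsAnalytically (laplaceRV P' Z) closedHalfPlane {s : ℂ | a < s.re})
    {θ : ℝ} (hθ : 0 ≤ θ) (hθa : θ < -a) : Integrable (fun x => Real.exp (θ * x)) ν := by
  have hZ := integrable_exp_of_extendsAnalytically hY.aemeasurable_limit
    (nonneg_of_tendstoInDistribution hY hY0) h hθa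
  refine ⟨by fun_prop, ?_⟩
  rw [hasFiniteIntegral_iff_ofReal (ae_of_all _ fun _ => (Real.exp_pos _).le)]
  refine (lintegral_exp_le_of_eventually_le hX hY hle hθ).trans_lt ?_
  exact (hasFiniteIntegral_iff_ofReal (ae_of_all _ fun _ => (Real.exp_pos _).le)).1 hZ.2

end Domination

/-! ### Analytic extension of the Laplace transforms -/

section Transforms

/-- The linear form `s ↦ -(s₁ u₁ + s₂ u₂)`. -/
def laplaceForm (u : ℝ × ℝ) : ℂ × ℂ →L[ℂ] ℂ :=
  -((u.1 : ℂ) • ContinuousLinearMap.fst ℂ ℂ ℂ + (u.2 : ℂ) • ContinuousLinearMap.snd ℂ ℂ ℂ)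

lemma laplaceForm_apply (u : ℝ × ℝ) (s : ℂ × ℂ) :
    laplaceForm u s = -(s.1 * (u.1 : ℂ) + s.2 * (u.2 : ℂ)) := by
  simp [laplaceForm, mul_comm]

lemma laplaceForm_re (u : ℝ × ℝ) (s : ℂ × ℂ) :
    (laplaceForm u s).re = -(s.1.re * u.1 + s.2.re * u.2) := by
  simp [laplaceForm_apply]

lemma norm_laplaceForm_le (u : ℝ × ℝ) : ‖laplaceForm u‖ ≤ |u.1| + |u.2| := by
  refine ContinuousLinearMap.opNorm_le_bound _ (by positivity) fun s => ?_
  rw [laplaceForm_apply, norm_neg]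
  calc ‖s.1 * (u.1 : ℂ) + s.2 * (u.2 : ℂ)‖ ≤ ‖s.1‖ * |u.1| + ‖s.2‖ * |u.2| := by
        refine (norm_add_le _ _).trans_eq ?_
        simp
    _ ≤ ‖s‖ * |u.1| + ‖s‖ * |u.2| := by
        gcongr
        · exact norm_fst_le s
        · exact norm_snd_le s
    _ = _ := by ring

lemma continuous_laplaceForm : Continuous laplaceForm := by
  unfold laplaceForm
  fun_prop

/-- An integral against a density, as an integral against the measure. -/
lemma integral_mul_density {α : Type*} [TopologicalSpace α] [MeasurableSpace α]
    [OpensMeasurableSpace α] {μ : Measure α} {D : Set α} (hD : MeasurableSet D) {φ : α → ℝ}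
    (hφ : IsRegular φ D) (f : α → ℂ) :
    ∫ u in D, f u * (φ u : ℂ) ∂μ =
      ∫ u, f u ∂(μ.restrict D).withDensity (fun u => ENNReal.ofReal (φ u)) := by
  rw [integral_withDensity_eq_integral_toReal_smul₀
    (hφ.continuousOn.aemeasurable hD).ennreal_ofReal (ae_of_all _ fun _ => ENNReal.ofReal_lt_top)]
  refine setIntegral_congr_fun hD fun u hu => ?_
  rw [ENNReal.toReal_ofReal (hφ.nonneg u hu), Complex.real_smul, mul_comm]

variable {Φ : Measure (ℝ × ℝ)}

/-- The term `r * (|u.1| + |u.2|)` bounds `r * ‖laplaceForm u‖`, the margin needed for the power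
series; `g` has to dominate only on `D`. -/
theorem analyticAt_laplace₂ {D : Set (ℝ × ℝ)} (hD : MeasurableSet D) {φ : ℝ × ℝ → ℝ}
    (hφ : IsRegular φ D)
    (hΦ : Φ.restrict D = (volume.restrict D).withDensity fun u => ENNReal.ofReal (φ u))
    {s : ℂ × ℂ} {r : ℝ} (hr : 0 < r) {g : ℝ × ℝ → ℝ} (hg : Integrable g Φ)
    (hle : ∀ u ∈ D, Real.exp (-(s.1.re * u.1 + s.2.re * u.2) + r * (|u.1| + |u.2|)) ≤ g u) :
    AnalyticAt ℂ (laplace₂ D φ) s := by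
  have heq : laplace₂ D φ = fun s => ∫ u, Complex.exp (laplaceForm u s) ∂Φ.restrict D := by
    ext s
    simp_rw [laplace₂, integral_mul_density hD hφ, ← hΦ, laplaceForm_apply]
  rw [heq]
  refine analyticAt_integral_cexp continuous_laplaceForm.aestronglyMeasurable hr ?_
  refine hg.restrict.mono' ?_ ?_
  · refine Continuous.aestronglyMeasurable ?_
    simp_rw [laplaceForm_re]
    have := continuous_laplaceForm
    fun_prop
  · filter_upwards [ae_restrict_mem hD] with u hu
    rw [Real.norm_eq_abs, Real.abs_exp, laplaceForm_re]
    refine le_trans (Real.exp_le_exp.2 ?_) (hle u hu)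
    gcongr
    exact norm_laplaceForm_le u

/-- On the cone `0 ≤ x ≤ y` a linear inequality need only be checked on the rays (0, 1) and (1, 1):
the gap between the sides is the sum of `e₁`, `e₂` and `e₃`. -/
lemma exponent_le {x y σ₁ σ₂ r θ : ℝ} (hx : 0 ≤ x) (hxy : x ≤ y) (hr : 0 ≤ r)
    (h₁ : -σ₂ + 2 * r ≤ θ) (h₂ : -(σ₁ + σ₂) + 2 * r ≤ θ) :
    -(σ₁ * x + σ₂ * y) + r * (x + y) ≤ θ * y := by
  have e₁ := mul_nonneg hx (sub_nonneg.2 h₂)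
  have e₂ := mul_nonneg (sub_nonneg.2 hxy) (sub_nonneg.2 h₁)
  have e₃ := mul_nonneg hr (sub_nonneg.2 hxy)
  linarith

/-- The domain condition says that -σ₂ and -(σ₁ + σ₂) are both less than -a. These inequalities are
strict, so a `θ` fits in between, and half of the remaining gap serves as `r`. -/
lemma exists_exponent {a σ₁ σ₂ : ℝ} (ha : a < 0) (h : max a (a - σ₁) < σ₂) :
    ∃ θ r : ℝ, 0 ≤ θ ∧ θ < -a ∧ 0 < r ∧ -σ₂ + 2 * r ≤ θ ∧ -(σ₁ + σ₂) + 2 * r ≤ θ := by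
  obtain ⟨h₁, h₂⟩ := max_lt_iff.1 h
  obtain ⟨θ, hm, hθ⟩ := exists_between (show max 0 (max (-σ₂) (-(σ₁ + σ₂))) < -a from
    max_lt (by linarith) (max_lt (by linarith) (by linarith)))
  obtain ⟨h0, h3⟩ := max_lt_iff.1 hm
  refine ⟨θ, (θ - max (-σ₂) (-(σ₁ + σ₂))) / 2, h0.le, hθ, by linarith, ?_, ?_⟩
  · linarith [le_max_left (-σ₂) (-(σ₁ + σ₂))]
  · linarith [le_max_right (-σ₂) (-(σ₁ + σ₂))]

theorem extendsAnalytically_laplace_Γ₁ {φ : ℝ × ℝ → ℝ} (hφ : IsRegular φ Γ₁)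
    (hΦ : Φ.restrict Γ₁ = (volume.restrict Γ₁).withDensity fun u => ENNReal.ofReal (φ u))
    {a : ℝ} (ha : a < 0)
    (hexp : ∀ θ, 0 ≤ θ → θ < -a → Integrable (fun u : ℝ × ℝ => Real.exp (θ * u.2)) Φ) :
    ExtendsAnalytically (laplace₂ Γ₁ φ) closedQuadrant
      {s : ℂ × ℂ | max a (a - s.1.re) < s.2.re} := by
  -- The extension is the integral itself, hence `rfl` for the agreement on the quadrant.
  refine ⟨fun s hs => max_lt (ha.trans_le hs.2) (by linarith [hs.1, hs.2]), _, fun s hs => ?_,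
    fun _ _ => rfl⟩
  obtain ⟨θ, r, hθ, hθa, hr, h₁, h₂⟩ := exists_exponent ha hs
  have hm : MeasurableSet Γ₁ :=
    (measurableSet_lt measurable_const measurable_fst).inter
      (measurableSet_lt measurable_fst measurable_snd)
  refine analyticAt_laplace₂ hm hφ hΦ hr (hexp θ hθ hθa) fun u hu => Real.exp_le_exp.2 ?_
  rw [abs_of_pos hu.1, abs_of_pos (hu.1.trans hu.2)]
  exact exponent_le hu.1.le hu.2.le hr.le h₁ h₂

theorem extendsAnalytically_laplace_Γ₂ {φ : ℝ × ℝ → ℝ} (hφ : IsRegular φ Γ₂)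
    (hΦ : Φ.restrict Γ₂ = (volume.restrict Γ₂).withDensity fun u => ENNReal.ofReal (φ u))
    {a : ℝ} (ha : a < 0)
    (hexp : ∀ θ, 0 ≤ θ → θ < -a → Integrable (fun u : ℝ × ℝ => Real.exp (θ * u.1)) Φ) :
    ExtendsAnalytically (laplace₂ Γ₂ φ) closedQuadrant
      {s : ℂ × ℂ | max a (a - s.2.re) < s.1.re} := by
  refine ⟨fun s hs => max_lt (ha.trans_le hs.1) (by linarith [hs.1, hs.2]), _, fun s hs => ?_,
    fun _ _ => rfl⟩
  obtain ⟨θ, r, hθ, hθa, hr, h₁, h₂⟩ := exists_exponent ha hs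
  have hm : MeasurableSet Γ₂ :=
    (measurableSet_lt measurable_const measurable_snd).inter
      (measurableSet_lt measurable_snd measurable_fst)
  refine analyticAt_laplace₂ hm hφ hΦ hr (hexp θ hθ hθa) fun u hu => Real.exp_le_exp.2 ?_
  rw [abs_of_pos hu.1, abs_of_pos (hu.1.trans hu.2), add_comm (_ * _), add_comm u.1]
  exact exponent_le hu.1.le hu.2.le hr.le h₁ h₂

theorem extendsAnalytically_laplace₁ {ψ : ℝ → ℝ} (hψ : IsRegular ψ (Ioi 0)) {a : ℝ} (ha : a < 0)
    (hexp : ∀ θ, 0 ≤ θ → θ < -a → Integrable (fun x : ℝ => Real.exp (θ * x))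
      ((volume.restrict (Ioi 0)).withDensity fun x => ENNReal.ofReal (ψ x))) :
    ExtendsAnalytically (laplace₁ ψ) closedHalfPlane {s : ℂ | a < s.re} := by
  refine ⟨fun s hs => ha.trans_le hs, _, fun s hs => ?_, fun _ _ => rfl⟩
  -- With `σ₁ = 0` the two conditions of the planar case coincide.
  obtain ⟨θ, r, hθ, hθa, hr, h₁, -⟩ := exists_exponent (σ₁ := 0) (σ₂ := s.re) ha (by simpa using hs)
  set ℓ : ℝ → ℂ →L[ℂ] ℂ := fun x => -((x : ℂ) • ContinuousLinearMap.id ℂ ℂ) with hℓ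
  have hℓc : Continuous ℓ := by fun_prop
  have happ : ∀ x s, ℓ x s = -(s * (x : ℂ)) := fun x s => by simp [hℓ, mul_comm]
  have hre : ∀ x, (ℓ x s).re = -(s.re * x) := fun x => by simp [happ]
  have heq : laplace₁ ψ = fun s => ∫ x, Complex.exp (ℓ x s)
      ∂(volume.restrict (Ioi 0)).withDensity fun x => ENNReal.ofReal (ψ x) := by
    ext s
    simp_rw [laplace₁, integral_mul_density measurableSet_Ioi hψ, happ]
  rw [heq]
  refine analyticAt_integral_cexp hℓc.aestronglyMeasurable hr ?_
  refine (hexp θ hθ hθa).mono' ?_ ?_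
  · refine Continuous.aestronglyMeasurable ?_
    simp_rw [hre]
    fun_prop
  · refine (withDensity_absolutelyContinuous _ _).ae_le ?_
    filter_upwards [ae_restrict_mem measurableSet_Ioi] with x hx
    have hx0 : 0 < x := hx
    rw [Real.norm_eq_abs, Real.abs_exp, hre, hℓ, norm_neg, norm_smul, ContinuousLinearMap.norm_id,
      mul_one, Complex.norm_real, Real.norm_eq_abs, abs_of_pos hx0, Real.exp_le_exp]
    nlinarith

end Transforms

end SQF

end

/-! ### The main theorem -/

theorem mainTheorem10
    {Ω Ω' : Type*} [MeasurableSpace Ω] [MeasurableSpace Ω']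
    (P : Measure Ω) [IsProbabilityMeasure P] (P' : Measure Ω') [IsProbabilityMeasure P']
    -- arrival rates, service rates and service laws; stability
    (lam mu : Fin 2 → ℝ) (B : Fin 2 → Measure ℝ) (hB : ∀ j, SQF.IsServiceLaw (B j) (mu j))
    (hstable : lam 0 / mu 0 + lam 1 / mu 1 < 1)
    (τ T : Fin 2 → ℕ → Ω → ℝ) (hA : SQF.IsArrivalModel P lam B τ T)
    -- the stationary SQF workload process, its law and its densities
    (U : ℝ → Ω → ℝ × ℝ) (hU : SQF.IsWorkload P τ T SQF.sqf U)
    (Φ : Measure (ℝ × ℝ)) (hΦ : SQF.HasStationaryLaw P U Φ)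
    (φ₁ φ₂ : ℝ × ℝ → ℝ) (ψ₁ ψ₂ : ℝ → ℝ) (hdens : SQF.HasRegularDensities Φ φ₁ φ₂ ψ₁ ψ₂)
    -- the HoL workload processes: queue no. 2 has priority in `V₁`, queue no. 1 in `V₂`
    (V₁ V₂ : ℝ → Ω → ℝ × ℝ)
    (hV₁ : SQF.IsWorkload P τ T SQF.hol₂ V₁) (hV₂ : SQF.IsWorkload P τ T SQF.hol₁ V₂)
    -- the limits in law of the low priority workloads, and their Laplace transforms
    (Ubar₁ Ubar₂ : Ω' → ℝ)
    (hlim₁ : TendstoInDistribution (fun t ω => (V₁ t ω).1) atTop Ubar₁ (fun _ => P) P')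
    (hlim₂ : TendstoInDistribution (fun t ω => (V₂ t ω).2) atTop Ubar₂ (fun _ => P) P')
    (a₁ a₂ : ℝ) (ha₁ : a₁ < 0) (ha₂ : a₂ < 0)
    (hL₁ : SQF.ExtendsAnalytically (SQF.laplaceRV P' Ubar₁) SQF.closedHalfPlane
      {s : ℂ | a₁ < s.re})
    (hL₂ : SQF.ExtendsAnalytically (SQF.laplaceRV P' Ubar₂) SQF.closedHalfPlane
      {s : ℂ | a₂ < s.re}) :
    -- F₁ and G₂
    SQF.ExtendsAnalytically (SQF.laplace₂ SQF.Γ₁ φ₁) SQF.closedQuadrant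
      {s : ℂ × ℂ | max a₂ (a₂ - s.1.re) < s.2.re} ∧
    SQF.ExtendsAnalytically (SQF.laplace₁ ψ₂) SQF.closedHalfPlane {s : ℂ | a₂ < s.re} ∧
    -- F₂ and G₁
    SQF.ExtendsAnalytically (SQF.laplace₂ SQF.Γ₂ φ₂) SQF.closedQuadrant
      {s : ℂ × ℂ | max a₁ (a₁ - s.2.re) < s.1.re} ∧
    SQF.ExtendsAnalytically (SQF.laplace₁ ψ₁) SQF.closedHalfPlane {s : ℂ | a₁ < s.re} := by

  have hexp₂ : ∀ θ, 0 ≤ θ → θ < -a₂ → Integrable (fun u : ℝ × ℝ => Real.exp (θ * u.2)) Φ := by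
    intro θ hθ hθa
    have h := SQF.integrable_exp_of_eventually_le (X := fun t ω => (U t ω).2)
      (fun t ht => HasLaw.fun_comp (Y := Prod.snd) ⟨by fun_prop, rfl⟩ (hΦ t ht)) hlim₂
      (hV₂.nonneg.mono fun ω h t ht => (h t ht).2)
      (SQF.eventually_snd_le_hol₁ hA hB hstable hU hV₂) hL₂ hθ hθa
    -- `h` concerns the image of `Φ` under the second projection; it is pulled back to `Φ`.
    exact h.comp_measurable (by fun_prop)
  have hexp₁ : ∀ θ, 0 ≤ θ → θ < -a₁ → Integrable (fun u : ℝ × ℝ => Real.exp (θ * u.1)) Φ := by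
    intro θ hθ hθa
    have h := SQF.integrable_exp_of_eventually_le (X := fun t ω => (U t ω).1)
      (fun t ht => HasLaw.fun_comp (Y := Prod.fst) ⟨by fun_prop, rfl⟩ (hΦ t ht)) hlim₁
      (hV₁.nonneg.mono fun ω h t ht => (h t ht).1)
      (SQF.eventually_fst_le_hol₂ hA hB hstable hU hV₁) hL₁ hθ hθa
    exact h.comp_measurable (by fun_prop)
  refine ⟨SQF.extendsAnalytically_laplace_Γ₁ hdens.regular_φ₁ hdens.cone₁ ha₂ hexp₂,
    SQF.extendsAnalytically_laplace₁ hdens.regular_ψ₂ ha₂ fun θ hθ hθa => ?_,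
    SQF.extendsAnalytically_laplace_Γ₂ hdens.regular_φ₂ hdens.cone₂ ha₁ hexp₁,
    SQF.extendsAnalytically_laplace₁ hdens.regular_ψ₁ ha₁ fun θ hθ hθa => ?_⟩
  -- On the half-line `δ₂` the law `Φ` is the image of the measure with density `ψ₂` under `x ↦ (0,
  -- x)`, so the same moment bound applies to `ψ₂`.
  · have h := (hexp₂ θ hθ hθa).restrict (s := SQF.δ₂)
    rw [hdens.boundary₂] at h
    exact h.comp_measurable (by fun_prop)
  · have h := (hexp₁ θ hθ hθa).restrict (s := SQF.δ₁)
    rw [hdens.boundary₁] at h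
    exact h.comp_measurable (by fun_prop)
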